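/- For $\alpha,\beta>0$ let $G_{\alpha,\beta}$ denote a gamma random variable with density $\frac{\beta^{\alpha}t^{\alpha-1}}{\Gamma(\alpha)}e^{-\beta t}$ on $t\ge 0$ (and $0$ for $t<0$). For $\vec\alpha_r=(\alpha_{r1},\dots,\alpha_{rn})$ and $\vec\beta_r=(\beta_{r1},\dots,\beta_{rn})$ with all entries positive, let $\mathcal G_r=\sum_{i=1}^n G_{\alpha_{ri},\beta_{ri}}$ with independent summands, $r=1,2$. For $x,y\in\mathbb R^m$ write $x\prec y$ ($x$ is majorized by $y$) if $\sum_{i=1}^m x_i=\sum_{i=1}^m y_i$ and, for every $k\le m$, the sum of the $k$ largest components of $x$ is at most the sum of the $k$ largest components of $y$. On pairs $(x,y)\in\mathbb R^n\times\mathbb R^n$, identified when they differ by one permutation of the coordinates applied to both vectors simultaneously, consider the following relations between $(x_1,y_1)$ and $(x_2,y_2)$. (i) There are $i<j$ with $(y_{2j}-y_{2i})(x_{2j}-x_{2i})\le 0$, $(x_{1i},x_{1j})\prec(x_{2i},x_{2j})$, $x_{1m}=x_{2m}$ for $m\ne i,j$, and $y_1=y_2$. (ii) There are $i<j$ with $(y_{2j}-y_{2i})(x_{2j}-x_{2i})\le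 0$, $(y_{1i},y_{1j})\prec(y_{2i},y_{2j})$, $y_{1m}=y_{2m}$ for $m\ne i,j$, and $x_1=x_2$. (iii) $x_{1i}\le x_{2i}$ for all $i$, and $y_1=y_2$. (iv) $y_{1i}\ge y_{2i}$ for all $i$, and $x_1=x_2$. The reverse-coupled majorization order is the reflexive-transitive relation generated by (i) and (ii). The reverse-coupled weakly sub-sup majorization order is the reflexive-transitive relation generated by the reverse-coupled majorization order together with (iii) and (iv); its finite chains run through arbitrary pairs in $\mathbb R^n\times\mathbb R^n$. Theorem. If $(\vec\alpha_1,\vec\beta_1)$ is below $(\vec\alpha_2,\vec\beta_2)$ in the reverse-coupled weakly sub-sup majorization order, then $\mathcal G_1\le_{conv}\mathcal G_2$ in the convolution order. That is, $\mathcal G_2$ has the same distribution as $X+Z$, where $X$ has the distribution of $\mathcal G_1$, $Z\ge 0$, and $Z$ is independent of $X$. -/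

import Mathlib

open MeasureTheory ProbabilityTheory

/-- The vector with the components of `x` arranged in increasing order. -/
noncomputable def sortUp {n : ℕ} (x : Fin n → ℝ) : Fin n → ℝ := x ∘ Tuple.sort x

/-- The vector with the components of `x` arranged in decreasing order. -/
noncomputable def sortDown {n : ℕ} (x : Fin n → ℝ) : Fin n → ℝ := fun i => sortUp x i.rev

/-- `x ≺_w y`: for every `k`, the sum of the `k` largest components of `x` is at most that
of `y`. -/
def WeakSubMajorized {n : ℕ} (x y : Fin n → ℝ) : Prop :=
  ∀ k : Fin n, ∑ i ∈ Finset.Iic k, sortDown x i ≤ ∑ i ∈ Finset.Iic k, sortDown y i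

/-- `x ≺ y`: `x ≺_w y` and the total sums agree. -/
def Majorized {n : ℕ} (x y : Fin n → ℝ) : Prop :=
  WeakSubMajorized x y ∧ ∑ i, x i = ∑ i, y i

/-- A pair of vectors in `ℝⁿ`. -/
abbrev VecPair (n : ℕ) : Type := (Fin n → ℝ) × (Fin n → ℝ)

/-- `u =ᵃ v`: the two pairs agree up to one permutation of the coordinates, applied to both
vectors simultaneously. -/
def ArrEq {n : ℕ} (u v : VecPair n) : Prop :=
  ∃ π : Equiv.Perm (Fin n), u.1 = v.1 ∘ π ∧ u.2 = v.2 ∘ π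

/-- Relation (i): at two coordinates `i < j` at which `v` is reversely ordered, the first vectors
are related by majorization; everything else is unchanged. -/
def RcStepFst {n : ℕ} (u v : VecPair n) : Prop :=
  ∃ i j : Fin n, i < j ∧ (v.2 j - v.2 i) * (v.1 j - v.1 i) ≤ 0 ∧
    Majorized ![u.1 i, u.1 j] ![v.1 i, v.1 j] ∧
    (∀ m, m ≠ i → m ≠ j → u.1 m = v.1 m) ∧ u.2 = v.2

/-- Relation (ii): at two coordinates `i < j` at which `v` is reversely ordered, the second vectors
are related by majorization; everything else is unchanged. -/
def RcStepSnd {n : ℕ} (u v : VecPair n) : Prop :=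
  ∃ i j : Fin n, i < j ∧ (v.2 j - v.2 i) * (v.1 j - v.1 i) ≤ 0 ∧
    Majorized ![u.2 i, u.2 j] ![v.2 i, v.2 j] ∧
    (∀ m, m ≠ i → m ≠ j → u.2 m = v.2 m) ∧ u.1 = v.1

/-- The reverse-coupled majorization order: a finite chain of relations (i) and (ii), on pairs of
vectors up to simultaneous permutation of the coordinates. -/
def RcMajorized {n : ℕ} : VecPair n → VecPair n → Prop :=
  Relation.ReflTransGen fun u v => ArrEq u v ∨ RcStepFst u v ∨ RcStepSnd u v

/-- Relation (iii): the first vector increases coordinatewise. -/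
def RaiseFst {n : ℕ} (u v : VecPair n) : Prop :=
  (∀ i, u.1 i ≤ v.1 i) ∧ u.2 = v.2

/-- Relation (iv): the second vector decreases coordinatewise. -/
def LowerSnd {n : ℕ} (u v : VecPair n) : Prop :=
  (∀ i, v.2 i ≤ u.2 i) ∧ u.1 = v.1

/-- The reverse-coupled weakly sub-sup majorization order: generated by the reverse-coupled
majorization order together with relations (iii) and (iv). -/
def RcWeakMajorized {n : ℕ} : VecPair n → VecPair n → Prop :=
  Relation.ReflTransGen fun u v => RcMajorized u v ∨ RaiseFst u v ∨ LowerSnd u v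

/-- The convolution order `X₁ ≤_conv X₂` of real random variables: on some probability space there
are independent `X'` and `Z` such that `X'` has the law of `X₁`, `Z` is nonnegative, and `X₂` has
the law of `X' + Z`. -/
def ConvOrder {Ω₁ Ω₂ : Type*} [MeasurableSpace Ω₁] [MeasurableSpace Ω₂]
    (X₁ : Ω₁ → ℝ) (P₁ : Measure Ω₁) (X₂ : Ω₂ → ℝ) (P₂ : Measure Ω₂) : Prop :=
  ∃ (Ω : Type) (_ : MeasurableSpace Ω) (P : Measure Ω) (X' Z : Ω → ℝ),
    IsProbabilityMeasure P ∧ Measurable X' ∧ Measurable Z ∧ IndepFun X' Z P ∧ (∀ ω, 0 ≤ Z ω) ∧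
    IdentDistrib X' X₁ P P₁ ∧ IdentDistrib X₂ (fun ω => X' ω + Z ω) P₂ P

/-!
The law of a sum of independent gamma variables with shapes `αᵢ` and rates `βᵢ` is infinitely
divisible, with Lévy density `x⁻¹ ∑ αᵢ exp (-βᵢ x)` on `(0, ∞)` (`charFun_map_sum_gamma`). If this
density increases pointwise from the first parameters to the second, then the difference of the
two densities is the Lévy density of a law on `[0, ∞)`, and a variable `Z` with that law,
independent of the first sum, makes up the difference between the two sums.

The pointwise inequality is `RcWeakMajorized.posExpSum_le`. A chain may pass through pairs with
negative components, along which `∑ αᵢ exp (-βᵢ x)` need not be monotone. Replacing `αᵢ` by its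
positive part cures this: `∑ αᵢ⁺ exp (-βᵢ x)` increases along every generating relation and agrees
with the original sum at the two positive endpoints.

Laws are compared through characteristic functions. The gamma law is treated by a first-order
linear differential equation (`charFun_gammaMeasure`). A law with a given Lévy density is obtained
as a weak limit of convolution powers (`exists_charFun_eq_exp_levyExponent`), where tightness and
Prokhorov's theorem provide the limit.
-/

/-! ### The weighted exponential sum is monotone along the order -/

/-- The sum `∑ αᵢ⁺ exp (-βᵢ t)`. For positive `α`, `x⁻¹` times this sum at `t = x` is the density
of the Lévy measure of a sum of independent gamma variables. The positive parts are what makes the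
sum monotone along chains whose intermediate first vectors have negative components. -/
noncomputable def posExpSum {n : ℕ} (t : ℝ) (u : VecPair n) : ℝ :=
  ∑ i, max (u.1 i) 0 * Real.exp (-(u.2 i * t))

theorem sortDown_zero_eq_max (a b : ℝ) : sortDown ![a, b] 0 = max a b := by
  have hle (i : Fin 2) : ![a, b] i ≤ sortDown ![a, b] 0 := by
    have h := Tuple.monotone_sort ![a, b] (Fin.le_last ((Tuple.sort ![a, b]).symm i))
    simpa [sortDown, sortUp] using h
  apply le_antisymm
  · have (i : Fin 2) : ![a, b] i ≤ max a b := by fin_cases i <;> simp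
    exact this _
  · exact max_le (hle 0) (hle 1)

theorem Majorized.pair {a b c d : ℝ} (h : Majorized ![a, b] ![c, d]) :
    max a b ≤ max c d ∧ a + b = c + d := by
  obtain ⟨h1, h2⟩ := h
  refine ⟨?_, by simpa using h2⟩
  have h0 := h1 0
  have : (Finset.Iic (0 : Fin 2)) = {0} := rfl
  rw [this, Finset.sum_singleton, Finset.sum_singleton] at h0
  simpa only [sortDown_zero_eq_max] using h0

/-- A pair spread out towards the larger weight has a larger weighted sum of positive parts. -/
theorem weighted_posPart_le {a b c d w z : ℝ} (hz : 0 ≤ z) (hzw : z ≤ w) (ha : a ≤ c) (hb : b ≤ c)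
    (hs : a + b = c + d) :
    max a 0 * w + max b 0 * z ≤ max c 0 * w + max d 0 * z := by
  have h1 : max a 0 ≤ max c 0 := max_le_max_right 0 ha
  have h2 : max a 0 + max b 0 ≤ max c 0 + max d 0 := by grind
  nlinarith [mul_le_mul_of_nonneg_right h1 (sub_nonneg.2 hzw), mul_le_mul_of_nonneg_right h2 hz]

/-- A pair of exponents spread out so that the larger coefficient gets the smaller exponent. The
two-point convexity of the exponential comes from `E p * E q = E p' * E q'`. -/
theorem weighted_exp_le {A B p q p' q' t : ℝ} (hB : 0 ≤ B) (hBA : B ≤ A) (ht : 0 ≤ t)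
    (hp : p' ≤ p) (hq : p' ≤ q) (hs : p + q = p' + q') :
    A * Real.exp (-(p * t)) + B * Real.exp (-(q * t)) ≤
      A * Real.exp (-(p' * t)) + B * Real.exp (-(q' * t)) := by
  have hEp : Real.exp (-(p * t)) ≤ Real.exp (-(p' * t)) := by gcongr
  have hEq : Real.exp (-(q * t)) ≤ Real.exp (-(p' * t)) := by gcongr
  have hprod : Real.exp (-(p * t)) * Real.exp (-(q * t)) =
      Real.exp (-(p' * t)) * Real.exp (-(q' * t)) := by
    rw [← Real.exp_add, ← Real.exp_add]
    congr 1
    linear_combination (-t) * hs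
  have hpos := Real.exp_pos (-(p' * t))
  generalize Real.exp (-(p * t)) = x at *
  generalize Real.exp (-(q * t)) = y at *
  generalize Real.exp (-(p' * t)) = x' at *
  generalize Real.exp (-(q' * t)) = y' at *
  have hsum : x + y ≤ x' + y' := by
    refine le_of_mul_le_mul_left ?_ hpos
    nlinarith [mul_nonneg (sub_nonneg.2 hEp) (sub_nonneg.2 hEq)]
  nlinarith [mul_le_mul_of_nonneg_left hEp (sub_nonneg.2 hBA), mul_le_mul_of_nonneg_left hsum hB]

theorem sum_le_sum_of_eq_off_pair {n : ℕ} {F H : Fin n → ℝ} {i j : Fin n} (hij : i ≠ j)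
    (hoff : ∀ m, m ≠ i → m ≠ j → F m = H m) (hpair : F i + F j ≤ H i + H j) :
    ∑ m, F m ≤ ∑ m, H m := by
  have hsplit (K : Fin n → ℝ) : ∑ m, K m = K i + K j + ∑ m ∈ {i, j}ᶜ, K m := by
    rw [← Finset.sum_add_sum_compl {i, j} K, Finset.sum_pair hij]
  rw [hsplit F, hsplit H]
  have : ∑ m ∈ {i, j}ᶜ, F m = ∑ m ∈ {i, j}ᶜ, H m :=
    Finset.sum_congr rfl fun m hm => by
      simp only [Finset.mem_compl, Finset.mem_insert, Finset.mem_singleton, not_or] at hm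
      exact hoff m hm.1 hm.2
  linarith

theorem ArrEq.posExpSum_eq {n : ℕ} {u v : VecPair n} (h : ArrEq u v) (t : ℝ) :
    posExpSum t u = posExpSum t v := by
  obtain ⟨π, h1, h2⟩ := h
  simp only [posExpSum, h1, h2, Function.comp_apply]
  exact Equiv.sum_comp π fun i => max (v.1 i) 0 * Real.exp (-(v.2 i * t))

theorem RcStepFst.posExpSum_le {n : ℕ} {u v : VecPair n} (h : RcStepFst u v) {t : ℝ}
    (ht : 0 ≤ t) : posExpSum t u ≤ posExpSum t v := by
  obtain ⟨i, j, hij, hord, hmaj, hoff, h2⟩ := h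
  obtain ⟨hmax, hsum⟩ := hmaj.pair
  refine sum_le_sum_of_eq_off_pair hij.ne (fun m hi hj => by rw [hoff m hi hj, h2]) ?_
  rw [h2]
  rcases mul_nonpos_iff.1 hord with ⟨h1, h3⟩ | ⟨h1, h3⟩
  · rw [max_eq_left (sub_nonpos.1 h3)] at hmax
    refine weighted_posPart_le (Real.exp_pos _).le ?_ (le_of_max_le_left hmax)
      (le_of_max_le_right hmax) hsum
    have := sub_nonneg.1 h1
    gcongr
  · rw [max_eq_right (sub_nonneg.1 h3)] at hmax
    have hw : Real.exp (-(v.2 i * t)) ≤ Real.exp (-(v.2 j * t)) := by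
      have := sub_nonpos.1 h1
      gcongr
    linarith [weighted_posPart_le (Real.exp_pos _).le hw (le_of_max_le_right hmax)
      (le_of_max_le_left hmax) (by linarith : u.1 j + u.1 i = v.1 j + v.1 i)]

theorem RcStepSnd.posExpSum_le {n : ℕ} {u v : VecPair n} (h : RcStepSnd u v) {t : ℝ}
    (ht : 0 ≤ t) : posExpSum t u ≤ posExpSum t v := by
  obtain ⟨i, j, hij, hord, hmaj, hoff, h1⟩ := h
  obtain ⟨hmax, hsum⟩ := hmaj.pair
  refine sum_le_sum_of_eq_off_pair hij.ne (fun m hi hj => by rw [hoff m hi hj, h1]) ?_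
  rw [h1]
  rcases mul_nonpos_iff.1 hord with ⟨h2, h3⟩ | ⟨h2, h3⟩
  · rw [max_eq_right (sub_nonneg.1 h2)] at hmax
    have := le_of_max_le_left hmax
    have := le_of_max_le_right hmax
    exact weighted_exp_le (le_max_right _ _) (max_le_max_right 0 (sub_nonpos.1 h3)) ht
      (by linarith) (by linarith) hsum
  · rw [max_eq_left (sub_nonpos.1 h2)] at hmax
    have := le_of_max_le_left hmax
    have := le_of_max_le_right hmax
    linarith [weighted_exp_le (le_max_right (v.1 i) 0) (max_le_max_right 0 (sub_nonneg.1 h3)) ht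
      (by linarith : v.2 j ≤ u.2 j) (by linarith : v.2 j ≤ u.2 i)
      (by linarith : u.2 j + u.2 i = v.2 j + v.2 i)]

theorem RcMajorized.posExpSum_le {n : ℕ} {u v : VecPair n} (h : RcMajorized u v) {t : ℝ}
    (ht : 0 ≤ t) : posExpSum t u ≤ posExpSum t v := by
  induction h with
  | refl => exact le_rfl
  | tail _ hstep ih =>
    refine ih.trans ?_
    rcases hstep with h | h | h
    exacts [(h.posExpSum_eq t).le, h.posExpSum_le ht, h.posExpSum_le ht]

theorem RaiseFst.posExpSum_le {n : ℕ} {u v : VecPair n} (h : RaiseFst u v) (t : ℝ) :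
    posExpSum t u ≤ posExpSum t v := by
  obtain ⟨h1, h2⟩ := h
  unfold posExpSum
  rw [h2]
  gcongr with i
  exact h1 i

theorem LowerSnd.posExpSum_le {n : ℕ} {u v : VecPair n} (h : LowerSnd u v) {t : ℝ}
    (ht : 0 ≤ t) : posExpSum t u ≤ posExpSum t v := by
  obtain ⟨h2, h1⟩ := h
  unfold posExpSum
  rw [h1]
  gcongr with i
  exact h2 i

theorem RcWeakMajorized.posExpSum_le {n : ℕ} {u v : VecPair n} (h : RcWeakMajorized u v) {t : ℝ}
    (ht : 0 ≤ t) : posExpSum t u ≤ posExpSum t v := by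
  induction h with
  | refl => exact le_rfl
  | tail _ hstep ih =>
    refine ih.trans ?_
    rcases hstep with h | h | h
    exacts [h.posExpSum_le ht, h.posExpSum_le t, h.posExpSum_le ht]

theorem posExpSum_of_pos {n : ℕ} {α β : Fin n → ℝ} (hα : ∀ i, 0 < α i) (t : ℝ) :
    posExpSum t (α, β) = ∑ i, α i * Real.exp (-(β i * t)) :=
  Finset.sum_congr rfl fun i _ => by rw [max_eq_left (hα i).le]

/-! ### Lévy exponents of densities on the half-line -/

open Set Filter Topology Complex

/-- The Lévy exponent `∫₀^∞ (exp (i s x) - 1) h x dx` of the measure on `(0, ∞)` with density `h`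
(without drift). It converges absolutely as soon as `x * h x` is integrable. -/
noncomputable def levyExponent (h : ℝ → ℝ) (s : ℝ) : ℂ :=
  ∫ x in Ioi (0 : ℝ), (cexp (s * x * I) - 1) * h x

theorem norm_cexp_mul_I_sub_one_le (s x : ℝ) : ‖cexp (s * x * I) - 1‖ ≤ |s| * |x| := by
  have := Real.norm_exp_I_mul_ofReal_sub_one_le (x := s * x)
  rw [mul_comm I, ofReal_mul, Real.norm_eq_abs, abs_mul] at this
  exact this

theorem norm_cexp_mul_I_eq_one (s x : ℝ) : ‖cexp (s * x * I)‖ = 1 := by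
  rw [← ofReal_mul, norm_exp_ofReal_mul_I]

section
variable {h : ℝ → ℝ}

theorem norm_levyExponent_integrand_le (s x : ℝ) :
    ‖(cexp (s * x * I) - 1) * h x‖ ≤ |s| * ‖x * h x‖ := by
  rw [norm_mul, norm_mul, norm_real, Real.norm_eq_abs x, ← mul_assoc]
  gcongr
  exact norm_cexp_mul_I_sub_one_le s x

theorem integrableOn_levyExponent (hm : Measurable h)
    (hi : IntegrableOn (fun x => x * h x) (Ioi 0)) (s : ℝ) :
    IntegrableOn (fun x : ℝ => (cexp (s * x * I) - 1) * h x) (Ioi 0) :=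
  (hi.norm.const_mul |s|).mono' (by fun_prop)
    (.of_forall fun x => norm_levyExponent_integrand_le s x)

theorem hasDerivAt_levyExponent (hm : Measurable h)
    (hi : IntegrableOn (fun x => x * h x) (Ioi 0)) (s : ℝ) :
    HasDerivAt (levyExponent h)
      (∫ x in Ioi (0 : ℝ), I * (cexp (s * x * I) * (x * h x : ℝ))) s := by
  refine (hasDerivAt_integral_of_dominated_loc_of_deriv_le (x₀ := s) (s := univ) univ_mem
    (F := fun (s x : ℝ) => (cexp (s * x * I) - 1) * h x)
    (F' := fun (s x : ℝ) => I * (cexp (s * x * I) * (x * h x : ℝ)))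
    (bound := fun x => ‖x * h x‖)
    (.of_forall fun s => (integrableOn_levyExponent hm hi s).1)
    (integrableOn_levyExponent hm hi s) (by fun_prop) ?_ hi.norm ?_).2
  · refine .of_forall fun x s _ => ?_
    rw [norm_mul, norm_mul, norm_cexp_mul_I_eq_one, norm_real, norm_I, one_mul, one_mul]
  · refine .of_forall fun x s _ => ?_
    have h1 : HasDerivAt (fun s : ℝ => (s : ℂ) * x * I) (1 * x * I) s :=
      ((hasDerivAt_id s).ofReal_comp.mul_const (x : ℂ)).mul_const I
    refine ((h1.cexp.sub_const 1).mul_const (h x : ℂ)).congr_deriv ?_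
    push_cast
    ring

theorem integrableOn_cexp_mul (hm : Measurable h) (hi : IntegrableOn h (Ioi 0)) (s : ℝ) :
    IntegrableOn (fun x : ℝ => cexp (s * x * I) * h x) (Ioi 0) :=
  hi.norm.mono' (by fun_prop)
    (.of_forall fun x => by rw [norm_mul, norm_cexp_mul_I_eq_one, one_mul, norm_real])

theorem levyExponent_eq_sub (hm : Measurable h) (hi : IntegrableOn h (Ioi 0)) (s : ℝ) :
    levyExponent h s =
      (∫ x in Ioi (0 : ℝ), cexp (s * x * I) * h x) - (∫ x in Ioi 0, h x : ℝ) := by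
  have hi' : IntegrableOn (fun x => (h x : ℂ)) (Ioi 0) := hi.ofReal
  rw [← integral_complex_ofReal, ← integral_sub (integrableOn_cexp_mul hm hi s) hi',
    levyExponent]
  simp_rw [sub_mul, one_mul]

theorem levyExponent_zero : levyExponent h 0 = 0 := by simp [levyExponent]

/-! ### Infinitely divisible laws on the half-line -/

/-- A subprobability density on `(0, ∞)`, completed by an atom at `0` to a probability measure. -/
theorem exists_charFun_eq_one_add_levyExponent (hm : Measurable h) (h0 : ∀ x, 0 < x → 0 ≤ h x)
    (hi : IntegrableOn h (Ioi 0)) (h1 : ∫ x in Ioi 0, h x ≤ 1) :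
    ∃ μ : Measure ℝ, IsProbabilityMeasure μ ∧ (∀ᵐ x ∂μ, 0 ≤ x) ∧
      ∀ s, charFun μ s = 1 + levyExponent h s := by
  have hae : 0 ≤ᵐ[volume.restrict (Ioi 0)] h :=
    (ae_restrict_iff' measurableSet_Ioi).2 (.of_forall h0)
  have hm0 : 0 ≤ ∫ x in Ioi 0, h x := integral_nonneg_of_ae hae
  set ν : Measure ℝ := (volume.restrict (Ioi 0)).withDensity fun x => ENNReal.ofReal (h x) with hν
  have hνu : ν univ = ENNReal.ofReal (∫ x in Ioi 0, h x) := by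
    rw [hν, withDensity_apply _ MeasurableSet.univ, Measure.restrict_univ,
      ofReal_integral_eq_lintegral_ofReal hi hae]
  have hνf : IsFiniteMeasure ν := ⟨by rw [hνu]; exact ENNReal.ofReal_lt_top⟩
  set c : ENNReal := ENNReal.ofReal (1 - ∫ x in Ioi 0, h x) with hc
  have hcf : IsFiniteMeasure (c • Measure.dirac (0 : ℝ)) :=
    Measure.smul_finite _ ENNReal.ofReal_ne_top
  refine ⟨ν + c • Measure.dirac 0, ⟨?_⟩, ?_, fun s => ?_⟩
  · rw [Measure.add_apply, Measure.smul_apply, hνu, measure_univ, smul_eq_mul, mul_one, hc,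
      ← ENNReal.ofReal_add hm0 (by linarith)]
    simp
  · rw [ae_add_measure_iff]
    refine ⟨?_, ?_⟩
    · have : ∀ᵐ x ∂volume.restrict (Ioi (0 : ℝ)), 0 ≤ x :=
        (ae_restrict_iff' measurableSet_Ioi).2 (.of_forall fun x hx => le_of_lt hx)
      exact (withDensity_absolutelyContinuous _ _).ae_le this
    · exact Measure.ae_smul_measure
        ((ae_dirac_iff (p := fun x : ℝ => 0 ≤ x) measurableSet_Ici).2 le_rfl) c
  · have hexp (ρ : Measure ℝ) [IsFiniteMeasure ρ] :
        Integrable (fun x : ℝ => cexp (s * x * I)) ρ :=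
      (integrable_const (1 : ℝ)).mono' (by fun_prop)
        (.of_forall fun x => (norm_cexp_mul_I_eq_one s x).le)
    have hν' : ∫ x, cexp (s * x * I) ∂ν = ∫ x in Ioi (0 : ℝ), cexp (s * x * I) * h x := by
      rw [hν, integral_withDensity_eq_integral_toReal_smul (by fun_prop) (by simp)]
      refine integral_congr_ae (hae.mono fun x hx => ?_)
      simp only [ENNReal.toReal_ofReal hx, real_smul]
      ring
    rw [charFun_apply_real, integral_add_measure (hexp _) (hexp _), hν', integral_smul_measure,
      integral_dirac, levyExponent_eq_sub hm hi, hc, ENNReal.toReal_ofReal (by linarith), real_smul]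
    simp
    ring

/-- Convolution powers. -/
theorem exists_charFun_eq_pow (μ : Measure ℝ) [IsProbabilityMeasure μ] (hμ : ∀ᵐ x ∂μ, 0 ≤ x)
    (n : ℕ) :
    ∃ ν : Measure ℝ, IsProbabilityMeasure ν ∧ (∀ᵐ x ∂ν, 0 ≤ x) ∧
      ∀ s, charFun ν s = charFun μ s ^ n := by
  induction n with
  | zero =>
    refine ⟨Measure.dirac 0, inferInstance, ?_, fun s => ?_⟩
    · exact (ae_dirac_iff (p := fun x : ℝ => 0 ≤ x) measurableSet_Ici).2 le_rfl
    · simp [charFun_apply_real]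
  | succ n ih =>
    obtain ⟨ν, hν, hν0, hνs⟩ := ih
    refine ⟨ν.conv μ, inferInstance, ?_, fun s => by rw [charFun_conv, hνs, pow_succ]⟩
    rw [Measure.conv, ae_map_iff (by fun_prop) (p := fun x : ℝ => 0 ≤ x) measurableSet_Ici]
    filter_upwards [Measure.quasiMeasurePreserving_fst.ae hν0,
      Measure.quasiMeasurePreserving_snd.ae hμ] with x h1 h2 using add_nonneg h1 h2

/-- Lévy's continuity theorem in existence form, for laws on `[0, ∞)`. -/
theorem exists_charFun_eq_of_tendsto {μ : ℕ → Measure ℝ} [∀ n, IsProbabilityMeasure (μ n)]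
    (hμ : ∀ n, ∀ᵐ x ∂μ n, 0 ≤ x) {f : ℝ → ℂ} (hf : ContinuousAt f 0)
    (hlim : ∀ s, Tendsto (fun n => charFun (μ n) s) atTop (𝓝 (f s))) :
    ∃ ν : Measure ℝ, IsProbabilityMeasure ν ∧ (∀ᵐ x ∂ν, 0 ≤ x) ∧ ∀ s, charFun ν s = f s := by
  set M : ℕ → ProbabilityMeasure ℝ := fun n => ⟨μ n, inferInstance⟩ with hM
  have htight : IsTightMeasureSet
      {((m : ProbabilityMeasure ℝ) : Measure ℝ) | m ∈ range M} := by
    convert isTightMeasureSet_of_tendsto_charFun hf hlim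
    exact (range_comp Subtype.val M).symm
  obtain ⟨ν, -, hν⟩ := (isCompact_closure_of_isTightMeasureSet htight).exists_mapClusterPt
    (f := atTop) (u := M)
    (tendsto_principal.2 (.of_forall fun n => subset_closure (mem_range_self n)))
  obtain ⟨U, hU, hUν⟩ := mapClusterPt_iff_ultrafilter.1 hν
  refine ⟨ν, inferInstance, ?_, fun s => ?_⟩
  · have hle := ProbabilityMeasure.le_liminf_measure_open_of_tendsto hUν (isOpen_Iio (a := (0 : ℝ)))
    have hz (n : ℕ) : (M n : Measure ℝ) (Iio 0) = 0 := by
      change μ n (Iio 0) = 0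
      simpa [ae_iff, Iio_def] using hμ n
    simp only [hz, liminf_const, nonpos_iff_eq_zero] at hle
    simpa [ae_iff, Iio_def] using hle
  · have h1 := (ProbabilityMeasure.tendsto_iff_forall_integral_rclike_tendsto ℂ).1 hUν
      (BoundedContinuousFunction.innerProbChar s)
    simp_rw [← charFun_eq_integral_innerProbChar] at h1
    exact tendsto_nhds_unique h1 ((hlim s).mono_left hU)

/-- A nonnegative density `h` on `(0, ∞)` with `∫ x h x < ∞` is the Lévy density of an infinitely
divisible law on `[0, ∞)`. The law is the weak limit of the `n`-fold convolution powers of the laws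
with density `x h x / (C + n x)` on `(0, ∞)` and the remaining mass at `0`. -/
theorem exists_charFun_eq_exp_levyExponent (hm : Measurable h) (h0 : ∀ x, 0 < x → 0 ≤ h x)
    (hi : IntegrableOn (fun x => x * h x) (Ioi 0)) :
    ∃ μ : Measure ℝ, IsProbabilityMeasure μ ∧ (∀ᵐ x ∂μ, 0 ≤ x) ∧
      ∀ s, charFun μ s = cexp (levyExponent h s) := by
  set C : ℝ := (∫ x in Ioi 0, x * h x) + 1 with hC
  have hI0 : 0 ≤ ∫ x in Ioi 0, x * h x :=
    setIntegral_nonneg measurableSet_Ioi fun x hx => mul_nonneg (le_of_lt hx) (h0 x hx)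
  have hC0 : 0 < C := by linarith
  -- `C ≥ ∫ x h x` makes every `q n` a subprobability density; the `1` keeps `C` positive.
  set q : ℕ → ℝ → ℝ := fun n x => x * h x / (C + n * x) with hq
  have hqm (n : ℕ) : Measurable (q n) := by fun_prop
  have hq0 (n : ℕ) (x : ℝ) (hx : 0 < x) : 0 ≤ q n x :=
    div_nonneg (mul_nonneg hx.le (h0 x hx)) (by positivity)
  have hqle (n : ℕ) (x : ℝ) (hx : 0 < x) : q n x ≤ x * h x / C :=
    div_le_div_of_nonneg_left (mul_nonneg hx.le (h0 x hx)) hC0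
      (le_add_of_nonneg_right (by positivity))
  have hqi (n : ℕ) : IntegrableOn (q n) (Ioi 0) := by
    refine (hi.div_const C).mono' (by fun_prop)
      ((ae_restrict_iff' measurableSet_Ioi).2 (.of_forall fun x hx => ?_))
    rw [Real.norm_of_nonneg (hq0 n x hx)]
    exact hqle n x hx
  have hq1 (n : ℕ) : ∫ x in Ioi 0, q n x ≤ 1 := by
    refine (setIntegral_mono_on (hqi n) (hi.div_const C) measurableSet_Ioi (hqle n)).trans ?_
    rw [integral_div, div_le_one hC0]
    linarith
  choose ρ hρ hρ0 hρs using fun n =>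
    exists_charFun_eq_one_add_levyExponent (hqm n) (hq0 n) (hqi n) (hq1 n)
  choose μ hμ hμ0 hμs using fun n => exists_charFun_eq_pow (ρ n) (hρ0 n) n
  refine exists_charFun_eq_of_tendsto hμ0 (f := fun s => cexp (levyExponent h s)) ?_ fun s => ?_
  · exact ((hasDerivAt_levyExponent hm hi 0).continuousAt).cexp
  simp_rw [hμs, hρs]
  refine Complex.tendsto_one_add_pow_exp_of_tendsto ?_
  -- `n * q n x = h x * (n * x / (C + n * x))` is at most `h x` and tends to `h x`.
  have hmul (n : ℕ) : (n : ℂ) * levyExponent (q n) s =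
      ∫ x in Ioi (0 : ℝ), (cexp (s * x * I) - 1) * (n * q n x : ℝ) := by
    rw [levyExponent, ← integral_const_mul]
    congr 1 with x
    push_cast
    ring
  simp_rw [hmul]
  refine tendsto_integral_of_dominated_convergence (fun x => ‖(cexp (s * x * I) - 1) * h x‖)
    (fun n => by fun_prop) (integrableOn_levyExponent hm hi s).norm (fun n => ?_) ?_
  · refine (ae_restrict_iff' measurableSet_Ioi).2 (.of_forall fun x (hx : 0 < x) => ?_)
    rw [norm_mul, norm_mul, norm_real, norm_real, Real.norm_of_nonneg (h0 x hx),
      Real.norm_of_nonneg (mul_nonneg n.cast_nonneg (hq0 n x hx))]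
    gcongr
    rw [hq]
    dsimp only
    rw [← mul_div_assoc, div_le_iff₀ (by positivity)]
    nlinarith [mul_nonneg (h0 x hx) hC0.le]
  · refine (ae_restrict_iff' measurableSet_Ioi).2 (.of_forall fun x (hx : 0 < x) => ?_)
    refine Tendsto.const_mul _ ((continuous_ofReal.tendsto _).comp ?_)
    have hlim : Tendsto (fun n : ℕ => h x - h x * C / (C + n * x)) atTop (𝓝 (h x - 0)) :=
      tendsto_const_nhds.sub (tendsto_const_nhds.div_atTop
        (tendsto_atTop_add_const_left _ C (tendsto_natCast_atTop_atTop.atTop_mul_const hx)))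
    rw [sub_zero] at hlim
    refine hlim.congr fun n => ?_
    have : C + n * x ≠ 0 := by positivity
    simp only [hq]
    field_simp
    ring

end

/-! ### The Lévy exponent of the gamma law -/

theorem gammaPDFReal_of_pos {a r x : ℝ} (hx : 0 < x) :
    gammaPDFReal a r x = r ^ a / Real.Gamma a * x ^ (a - 1) * Real.exp (-(r * x)) := by
  rw [gammaPDFReal, if_pos hx.le]

theorem integrableOn_rpow_mul_exp_neg_mul {a r : ℝ} (ha : 0 < a) (hr : 0 < r) :
    IntegrableOn (fun x => x ^ (a - 1) * Real.exp (-(r * x))) (Ioi 0) :=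
  .of_integral_ne_zero (by
    rw [Real.integral_rpow_mul_exp_neg_mul_Ioi ha hr]
    have := Real.Gamma_pos_of_pos ha
    positivity)

theorem integrableOn_gammaPDFReal {a r : ℝ} (ha : 0 < a) (hr : 0 < r) :
    IntegrableOn (gammaPDFReal a r) (Ioi 0) :=
  IntegrableOn.congr_fun
    ((integrableOn_rpow_mul_exp_neg_mul ha hr).const_mul (r ^ a / Real.Gamma a))
    (fun x hx => by rw [gammaPDFReal_of_pos hx, mul_assoc]) measurableSet_Ioi

theorem rpow_eq_mul_rpow_sub_one {a x : ℝ} (hx : 0 < x) : x ^ a = x * x ^ (a - 1) := by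
  rw [Real.rpow_sub_one hx.ne']
  field_simp

theorem integrableOn_mul_gammaPDFReal {a r : ℝ} (ha : 0 < a) (hr : 0 < r) :
    IntegrableOn (fun x => x * gammaPDFReal a r x) (Ioi 0) :=
  IntegrableOn.congr_fun
    ((integrableOn_rpow_mul_exp_neg_mul (a := a + 1) (by positivity) hr).const_mul
      (r ^ a / Real.Gamma a))
    (fun x (hx : 0 < x) => by
      rw [gammaPDFReal_of_pos hx, add_sub_cancel_right, rpow_eq_mul_rpow_sub_one hx]
      ring) measurableSet_Ioi

theorem charFun_gammaMeasure_eq_integral {a r : ℝ} (ha : 0 < a) (hr : 0 < r) (s : ℝ) :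
    charFun (gammaMeasure a r) s =
      ∫ x in Ioi (0 : ℝ), cexp (s * x * I) * gammaPDFReal a r x := by
  have h0 := gammaPDFReal_nonneg ha hr
  have hm : Measurable (gammaPDF a r) := (measurable_gammaPDFReal a r).ennreal_ofReal
  rw [charFun_apply_real, gammaMeasure,
    integral_withDensity_eq_integral_toReal_smul hm (by simp [gammaPDF]),
    ← integral_Ici_eq_integral_Ioi, ← integral_indicator measurableSet_Ici]
  congr 1 with x
  by_cases hx : 0 ≤ x
  · rw [indicator_of_mem (mem_Ici.2 hx), gammaPDF, ENNReal.toReal_ofReal (h0 x), real_smul,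
      mul_comm]
  · rw [indicator_of_notMem (by simpa using hx), gammaPDF_of_neg (not_le.1 hx)]
    simp

theorem charFun_gammaMeasure_eq_one_add {a r : ℝ} (ha : 0 < a) (hr : 0 < r) (s : ℝ) :
    charFun (gammaMeasure a r) s = 1 + levyExponent (gammaPDFReal a r) s := by
  have hone : ∫ x in Ioi 0, gammaPDFReal a r x = 1 := by
    have := isProbabilityMeasure_gammaMeasure ha hr
    rw [← ofReal_inj, ← integral_complex_ofReal]
    simpa using (charFun_gammaMeasure_eq_integral ha hr 0).symm
  rw [charFun_gammaMeasure_eq_integral ha hr, levyExponent_eq_sub (measurable_gammaPDFReal a r)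
    (integrableOn_gammaPDFReal ha hr), hone, ofReal_one, add_sub_cancel]

/-- Integration by parts against `x * gammaPDFReal a r x`, whose derivative is
`(a - r * x) * gammaPDFReal a r x`. -/
theorem integral_mul_gammaPDFReal {a r : ℝ} (ha : 0 < a) (hr : 0 < r) (s : ℝ) :
    (r - s * I) * ∫ x in Ioi (0 : ℝ), cexp (s * x * I) * (x * gammaPDFReal a r x : ℝ) =
      a * charFun (gammaMeasure a r) s := by
  have hm := measurable_gammaPDFReal a r
  have hi0 := integrableOn_cexp_mul hm (integrableOn_gammaPDFReal ha hr) s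
  have hi1 := integrableOn_cexp_mul (h := fun x => x * gammaPDFReal a r x) (measurable_id.mul hm)
    (integrableOn_mul_gammaPDFReal ha hr) s
  obtain ⟨k, hk⟩ : ∃ k, k = r ^ a / Real.Gamma a := ⟨_, rfl⟩
  set F : ℝ → ℂ := fun x => cexp (s * x * I) * (k * (x ^ a * Real.exp (-(r * x))) : ℝ) with hF
  have hcont : ContinuousWithinAt F (Ici 0) 0 := by
    have : Continuous fun x : ℝ => x ^ a := Real.continuous_rpow_const ha.le
    exact Continuous.continuousWithinAt (by fun_prop)
  have hderiv (x : ℝ) (hx : x ∈ Ioi (0 : ℝ)) : HasDerivAt F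
      (a * (cexp (s * x * I) * gammaPDFReal a r x) -
        (r - s * I) * (cexp (s * x * I) * (x * gammaPDFReal a r x : ℝ))) x := by
    have hx0 : (0 : ℝ) < x := hx
    have h1 : HasDerivAt (fun x : ℝ => cexp (s * x * I)) (cexp (s * x * I) * (s * 1 * I)) x :=
      (((hasDerivAt_id x).ofReal_comp.const_mul (s : ℂ)).mul_const I).cexp
    have h2 : HasDerivAt (fun x : ℝ => k * (x ^ a * Real.exp (-(r * x))))
        (k * (a * x ^ (a - 1) * Real.exp (-(r * x)) +
          x ^ a * (Real.exp (-(r * x)) * -(r * 1)))) x :=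
      ((Real.hasDerivAt_rpow_const (Or.inl hx0.ne')).mul
        ((hasDerivAt_id x).const_mul r).neg.exp).const_mul k
    refine (h1.mul h2.ofReal_comp).congr_deriv ?_
    rw [gammaPDFReal_of_pos hx0, ← hk, rpow_eq_mul_rpow_sub_one hx0]
    push_cast
    ring
  have hlim : Tendsto F atTop (𝓝 0) := by
    rw [tendsto_zero_iff_norm_tendsto_zero]
    have h := ((tendsto_rpow_mul_exp_neg_mul_atTop_nhds_zero a r hr).const_mul k).norm
    rw [mul_zero, norm_zero] at h
    refine h.congr fun x => ?_
    simp only [hF]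
    rw [norm_mul (cexp _), norm_cexp_mul_I_eq_one, one_mul, norm_real, neg_mul]
  have hF0 : F 0 = 0 := by simp [hF, Real.zero_rpow ha.ne']
  have hparts := integral_Ioi_of_hasDerivAt_of_tendsto hcont hderiv
    ((hi0.const_mul (a : ℂ)).sub (hi1.const_mul (r - s * I : ℂ))) hlim
  rw [integral_sub (hi0.const_mul (a : ℂ)) (hi1.const_mul (r - s * I : ℂ)), integral_const_mul,
    integral_const_mul, hF0, sub_zero, ← charFun_gammaMeasure_eq_integral ha hr] at hparts
  linear_combination -hparts

/-- The Lévy density of the gamma law with shape `a` and rate `r`. -/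
noncomputable def gammaLevyDensity (a r x : ℝ) : ℝ := a * Real.exp (-(r * x)) / x

theorem measurable_gammaLevyDensity (a r : ℝ) : Measurable (gammaLevyDensity a r) := by
  unfold gammaLevyDensity
  fun_prop

theorem mul_gammaLevyDensity {a r x : ℝ} (hx : 0 < x) :
    x * gammaLevyDensity a r x = a * Real.exp (-(r * x)) := by
  rw [gammaLevyDensity, mul_div_cancel₀ _ hx.ne']

theorem integrableOn_mul_gammaLevyDensity {a r : ℝ} (hr : 0 < r) :
    IntegrableOn (fun x => x * gammaLevyDensity a r x) (Ioi 0) :=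
  IntegrableOn.congr_fun ((integrableOn_exp_mul_Ioi (neg_lt_zero.2 hr) 0).const_mul a)
    (fun x hx => by rw [mul_gammaLevyDensity hx, neg_mul]) measurableSet_Ioi

theorem hasDerivAt_levyExponent_gamma {a r : ℝ} (hr : 0 < r) (s : ℝ) :
    HasDerivAt (levyExponent (gammaLevyDensity a r)) (I * (a / (r - s * I))) s := by
  convert hasDerivAt_levyExponent (measurable_gammaLevyDensity a r)
    (integrableOn_mul_gammaLevyDensity hr) s using 1
  have hre : (s * I - r : ℂ).re < 0 := by simpa using hr
  have hne : (s * I - r : ℂ) ≠ 0 := fun h => by simp [h] at hre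
  have hne' : (r - s * I : ℂ) ≠ 0 := by rw [← neg_sub]; exact neg_ne_zero.2 hne
  rw [integral_const_mul]
  congr 1
  calc (a / (r - s * I) : ℂ) = a * ∫ x in Ioi (0 : ℝ), cexp ((s * I - r) * x) := by
        rw [integral_exp_mul_complex_Ioi hre, ofReal_zero, mul_zero, exp_zero]
        field_simp
        ring
    _ = ∫ x in Ioi (0 : ℝ), cexp (s * x * I) * (x * gammaLevyDensity a r x : ℝ) := by
        rw [← integral_const_mul]
        refine setIntegral_congr_fun measurableSet_Ioi fun x hx => ?_
        rw [mul_gammaLevyDensity hx, sub_mul, sub_eq_add_neg, exp_add]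
        push_cast
        ring_nf

/-- The Lévy–Khintchine representation of the gamma law. Both sides solve the linear equation
`φ' = (i a / (r - i s)) φ` with `φ 0 = 1`. -/
theorem charFun_gammaMeasure {a r : ℝ} (ha : 0 < a) (hr : 0 < r) (s : ℝ) :
    charFun (gammaMeasure a r) s = cexp (levyExponent (gammaLevyDensity a r) s) := by
  have hne (s : ℝ) : (r - s * I : ℂ) ≠ 0 := fun h => hr.ne' (by simpa using congrArg re h)
  have hφ (s : ℝ) : HasDerivAt (charFun (gammaMeasure a r))
      (I * (a / (r - s * I)) * charFun (gammaMeasure a r) s) s := by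
    rw [funext (charFun_gammaMeasure_eq_one_add ha hr)]
    refine ((hasDerivAt_levyExponent (measurable_gammaPDFReal a r)
      (integrableOn_mul_gammaPDFReal ha hr) s).const_add 1).congr_deriv ?_
    change _ = I * (a / (r - s * I)) * (1 + levyExponent (gammaPDFReal a r) s)
    rw [integral_const_mul, ← charFun_gammaMeasure_eq_one_add ha hr, mul_assoc,
      div_mul_eq_mul_div, ← integral_mul_gammaPDFReal ha hr, mul_div_cancel_left₀ _ (hne s)]
  have hquot (s : ℝ) : HasDerivAt (fun s => charFun (gammaMeasure a r) s *
      cexp (-levyExponent (gammaLevyDensity a r) s)) 0 s :=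
    ((hφ s).mul (hasDerivAt_levyExponent_gamma hr s).neg.cexp).congr_deriv (by ring)
  have hconst := is_const_of_deriv_eq_zero (fun s => (hquot s).differentiableAt)
    (fun s => (hquot s).deriv) s 0
  have := isProbabilityMeasure_gammaMeasure ha hr
  simp only [charFun_zero, levyExponent_zero, neg_zero, exp_zero, exp_neg] at hconst
  have hexp := exp_ne_zero (levyExponent (gammaLevyDensity a r) s)
  field_simp at hconst
  simpa using hconst

/-! ### Sums of independent gamma variables -/

theorem levyExponent_add {g h : ℝ → ℝ} (hg : Measurable g) (hh : Measurable h)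
    (hgi : IntegrableOn (fun x => x * g x) (Ioi 0)) (hhi : IntegrableOn (fun x => x * h x) (Ioi 0))
    (s : ℝ) : levyExponent (fun x => g x + h x) s = levyExponent g s + levyExponent h s := by
  unfold levyExponent
  rw [← integral_add (integrableOn_levyExponent hg hgi s) (integrableOn_levyExponent hh hhi s)]
  simp_rw [ofReal_add, mul_add]

/-- The Lévy density of a sum of independent gamma variables. -/
noncomputable def gammaSumLevyDensity {n : ℕ} (α β : Fin n → ℝ) (x : ℝ) : ℝ :=
  ∑ i, gammaLevyDensity (α i) (β i) x

section
variable {n : ℕ} {α β : Fin n → ℝ}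

theorem measurable_gammaSumLevyDensity : Measurable (gammaSumLevyDensity α β) :=
  Finset.measurable_fun_sum _ fun _ _ => measurable_gammaLevyDensity _ _

theorem integrableOn_mul_gammaSumLevyDensity (hβ : ∀ i, 0 < β i) :
    IntegrableOn (fun x => x * gammaSumLevyDensity α β x) (Ioi 0) := by
  simp_rw [gammaSumLevyDensity, Finset.mul_sum]
  exact integrable_finsetSum _ fun i _ => integrableOn_mul_gammaLevyDensity (hβ i)

theorem gammaSumLevyDensity_eq_div (hα : ∀ i, 0 < α i) (x : ℝ) :
    gammaSumLevyDensity α β x = posExpSum x (α, β) / x := by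
  rw [posExpSum_of_pos hα, Finset.sum_div]
  rfl

theorem levyExponent_gammaSumLevyDensity (hβ : ∀ i, 0 < β i) (s : ℝ) :
    levyExponent (gammaSumLevyDensity α β) s =
      ∑ i, levyExponent (gammaLevyDensity (α i) (β i)) s := by
  unfold levyExponent gammaSumLevyDensity
  rw [← integral_finsetSum _ fun i _ => integrableOn_levyExponent
    (measurable_gammaLevyDensity (α i) (β i)) (integrableOn_mul_gammaLevyDensity (hβ i)) s]
  simp_rw [ofReal_sum, Finset.mul_sum]

theorem charFun_map_sum_gamma (hα : ∀ i, 0 < α i) (hβ : ∀ i, 0 < β i)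
    {Ω : Type*} [MeasurableSpace Ω] {P : Measure Ω} {G : Fin n → Ω → ℝ}
    (hG : ∀ i, HasLaw (G i) (gammaMeasure (α i) (β i)) P) (hI : iIndepFun G P) (s : ℝ) :
    charFun (P.map fun ω => ∑ i, G i ω) s = cexp (levyExponent (gammaSumLevyDensity α β) s) := by
  rw [hI.charFun_map_fun_sum_eq_prod fun i => (hG i).aemeasurable, Finset.prod_apply,
    levyExponent_gammaSumLevyDensity hβ, exp_sum]
  exact Finset.prod_congr rfl fun i _ => by rw [(hG i).map_eq, charFun_gammaMeasure (hα i) (hβ i)]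

end

/-- If the law of `X₂` is the convolution of the law of `X₁` with a law on `[0, ∞)`, then
`X₁ ≤_conv X₂`. -/
theorem convOrder_of_map_eq_conv {Ω₁ Ω₂ : Type*} [MeasurableSpace Ω₁] [MeasurableSpace Ω₂]
    {X₁ : Ω₁ → ℝ} {P₁ : Measure Ω₁} [IsProbabilityMeasure P₁] {X₂ : Ω₂ → ℝ} {P₂ : Measure Ω₂}
    (hX₁ : AEMeasurable X₁ P₁) (hX₂ : AEMeasurable X₂ P₂) {ν : Measure ℝ}
    [IsProbabilityMeasure ν] (hν : ∀ᵐ x ∂ν, 0 ≤ x) (h : P₂.map X₂ = (P₁.map X₁).conv ν) :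
    ConvOrder X₁ P₁ X₂ P₂ := by
  have : IsProbabilityMeasure (P₁.map X₁) := Measure.isProbabilityMeasure_map hX₁
  -- `max z 0` equals `z` almost surely and is nonnegative everywhere.
  refine ⟨ℝ × ℝ, inferInstance, (P₁.map X₁).prod ν, Prod.fst, fun p => max p.2 0, inferInstance,
    measurable_fst, by fun_prop,
    indepFun_prod measurable_id (measurable_id.max measurable_const),
    fun p => le_max_right _ _, ⟨measurable_fst.aemeasurable, hX₁, ?_⟩,
    ⟨hX₂, by fun_prop, ?_⟩⟩
  · rw [Measure.map_fst_prod, measure_univ, one_smul]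
  · rw [h, Measure.conv]
    refine Measure.map_congr ?_
    filter_upwards [Measure.quasiMeasurePreserving_snd.ae hν] with p hp
    rw [max_eq_left hp]

theorem mainTheorem1 (n : ℕ) (α₁ α₂ β₁ β₂ : Fin n → ℝ)
    (hα₁ : ∀ i, 0 < α₁ i) (hα₂ : ∀ i, 0 < α₂ i)
    (hβ₁ : ∀ i, 0 < β₁ i) (hβ₂ : ∀ i, 0 < β₂ i)
    (h : RcWeakMajorized (α₁, β₁) (α₂, β₂))
    {Ω₁ Ω₂ : Type*} [MeasurableSpace Ω₁] [MeasurableSpace Ω₂]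
    (P₁ : Measure Ω₁) [IsProbabilityMeasure P₁] (P₂ : Measure Ω₂) [IsProbabilityMeasure P₂]
    (G₁ : Fin n → Ω₁ → ℝ) (G₂ : Fin n → Ω₂ → ℝ)
    (hG₁ : ∀ i, HasLaw (G₁ i) (gammaMeasure (α₁ i) (β₁ i)) P₁)
    (hG₂ : ∀ i, HasLaw (G₂ i) (gammaMeasure (α₂ i) (β₂ i)) P₂)
    (hI₁ : iIndepFun G₁ P₁) (hI₂ : iIndepFun G₂ P₂) :
    ConvOrder (fun ω => ∑ i, G₁ i ω) P₁ (fun ω => ∑ i, G₂ i ω) P₂ := by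
  have hX₁ : AEMeasurable (fun ω => ∑ i, G₁ i ω) P₁ :=
    Finset.aemeasurable_fun_sum _ fun i _ => (hG₁ i).aemeasurable
  have hX₂ : AEMeasurable (fun ω => ∑ i, G₂ i ω) P₂ :=
    Finset.aemeasurable_fun_sum _ fun i _ => (hG₂ i).aemeasurable
  set f₁ := gammaSumLevyDensity α₁ β₁ with hf₁
  set f₂ := gammaSumLevyDensity α₂ β₂ with hf₂
  have hm₁ : Measurable f₁ := measurable_gammaSumLevyDensity
  have hm₂ : Measurable f₂ := measurable_gammaSumLevyDensity
  have hi₁ : IntegrableOn (fun x => x * f₁ x) (Ioi 0) := integrableOn_mul_gammaSumLevyDensity hβ₁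
  have hi₂ : IntegrableOn (fun x => x * f₂ x) (Ioi 0) := integrableOn_mul_gammaSumLevyDensity hβ₂
  have hm : Measurable fun x => f₂ x - f₁ x := hm₂.sub hm₁
  have hi : IntegrableOn (fun x => x * (f₂ x - f₁ x)) (Ioi 0) := by
    simp_rw [mul_sub]
    exact hi₂.sub hi₁
  have hnonneg (x : ℝ) (hx : 0 < x) : 0 ≤ f₂ x - f₁ x := by
    rw [sub_nonneg, hf₁, hf₂, gammaSumLevyDensity_eq_div hα₁, gammaSumLevyDensity_eq_div hα₂]
    exact div_le_div_of_nonneg_right (h.posExpSum_le hx.le) hx.le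
  obtain ⟨ν, hν, hν0, hνs⟩ := exists_charFun_eq_exp_levyExponent hm hnonneg hi
  have := Measure.isProbabilityMeasure_map hX₁
  have := Measure.isProbabilityMeasure_map hX₂
  refine convOrder_of_map_eq_conv hX₁ hX₂ hν0 (Measure.ext_of_charFun (funext fun s => ?_))
  rw [charFun_conv, charFun_map_sum_gamma hα₁ hβ₁ hG₁ hI₁, charFun_map_sum_gamma hα₂ hβ₂ hG₂ hI₂,
    hνs, ← Complex.exp_add, ← levyExponent_add hm₁ hm hi₁ hi]
  simp_rw [add_sub_cancel]
  rfl
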